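/- Let $K$ be a field, $S=K[x,y,z]$ with the standard grading, $d\in\mathbb{N}$, and let $I\subset S$ be a graded ideal with $\dim_K I_d=d+1$. For $\omega\in\mathbb{R}^3$ let $\mathrm{in}_\omega(f)$ be the sum of the terms of $f\in S$ of minimal $\omega$-weight (a term with exponent $\nu$ has weight $\omega\cdot\nu$), and let $\mathrm{in}_\omega(I)$ be the ideal generated by all $\mathrm{in}_\omega(f)$, $f\in I$. Call $\omega,\omega'$ equivalent if $\mathrm{in}_\omega(I)_d=\mathrm{in}_{\omega'}(I)_d$. The degree-$d$ Gröbner fan $\mathrm{GF}(I)_d$ is the set of the closures of the equivalence classes in $\mathbb{R}^3$; its maximal cones are its elements that are maximal under inclusion. Let $N(d)$ be the set of all sets $J$ of $d+1$ exponents $\nu\in\mathbb{N}^3$ of monomials of degree $d$, and let $m_J=\sum_{\nu\in J}\nu$. Let $N(I,d)$ be the set of those $J\in N(d)$ for which the Plücker coordinate $P_J(I_d)$ is nonzero (the maximal minor with columns indexed by $J$ of the matrix expressing a basis of $I_d$ in the monomials of degree $d$), and let $M(I,d)=\{m_J: J\in N(I,d)\}$. (1) For each maximal cone $C$ of $\mathrm{GF}(I)_d$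 there is a unique $m\in M(I,d)$ such that $$C=\{\omega\in\mathbb{R}^3:\ \omega\cdot m\le\omega\cdot m'\ \text{ for all } m'\in M(I,d)\},$$ and the map that sends $C$ to this $m$ is injective. (2) Let $K$ be infinite. For $g\in\mathrm{GL}_3(K)$ let $g(I)$ be the image of $I$ under the linear change of coordinates $x_i\mapsto\sum_j g_{ij}x_j$, where $(x_1,x_2,x_3)=(x,y,z)$. There are a nonempty Zariski-open set $U\subset\mathrm{GL}_3(K)$, a set $\mathrm{gGF}(I)_d$ of cones (the degree-$d$ generic Gröbner fan) and a set $\mathrm{g}N(I,d)\subset N(d)$ such that $\mathrm{GF}(g(I))_d=\mathrm{gGF}(I)_d$ and $N(g(I),d)=\mathrm{g}N(I,d)$ for all $g\in U$; they consist of the cones, respectively the sets $J$, that belong to $\mathrm{GF}(g(I))_d$, respectively $N(g(I),d)$, for all $g$ in some nonempty Zariski-open set. Let $\mathrm{g}M(I,d)=\{m_J: J\in\mathrm{g}N(I,d)\}$. For each maximal cone $C$ of $\mathrm{gGF}(I)_d$ there is a unique $m\in\mathrm{g}M(I,d)$ such that $$C=\{\omega\in\mathbb{R}^3:\ \omega\cdot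 m\le\omega\cdot m'\ \text{ for all } m'\in\mathrm{g}M(I,d)\},$$ and the map that sends $C$ to this $m$ is injective. -/

import Mathlib

noncomputable section

namespace GenericGroebner

open MvPolynomial

variable {K : Type*} [Field K]

attribute [local instance] MvPolynomial.gradedAlgebra in
/-- `I` is a graded ideal of `K[x,y,z]` with respect to the standard grading. -/
def IsGradedIdeal (I : Ideal (MvPolynomial (Fin 3) K)) : Prop :=
  I.IsHomogeneous (homogeneousSubmodule (Fin 3) K)

/-- The scalar product `ω · m` of a real weight vector and an exponent vector in `ℕ³`. -/
def wt (ω : Fin 3 → ℝ) (m : Fin 3 →₀ ℕ) : ℝ := ∑ i, ω i * (m i : ℝ)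

/-- The initial form `in_ω(f)`: the sum of the terms of `f` of minimal `ω`-weight
(with `in_ω(0) = 0`). -/
def initialForm (ω : Fin 3 → ℝ) (f : MvPolynomial (Fin 3) K) : MvPolynomial (Fin 3) K :=
  open Classical in
  ∑ ν ∈ f.support.filter (fun ν => ∀ μ ∈ f.support, wt ω ν ≤ wt ω μ), monomial ν (coeff ν f)

/-- The initial ideal `in_ω(I)`, generated by the initial forms of all elements of `I`. -/
def initialIdeal (ω : Fin 3 → ℝ) (I : Ideal (MvPolynomial (Fin 3) K)) :
    Ideal (MvPolynomial (Fin 3) K) :=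
  Ideal.span (initialForm ω '' (I : Set (MvPolynomial (Fin 3) K)))

/-- The degree `d` component `I_d`, as a `K`-subspace of `K[x,y,z]`. -/
def degPart (I : Ideal (MvPolynomial (Fin 3) K)) (d : ℕ) :
    Submodule K (MvPolynomial (Fin 3) K) :=
  I.restrictScalars K ⊓ homogeneousSubmodule (Fin 3) K d

/-- The equivalence class of `ω` for the relation `in_ω(I)_d = in_ω'(I)_d`. -/
def groebnerClass (I : Ideal (MvPolynomial (Fin 3) K)) (d : ℕ) (ω : Fin 3 → ℝ) :
    Set (Fin 3 → ℝ) :=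
  {ω' | degPart (initialIdeal ω' I) d = degPart (initialIdeal ω I) d}

/-- The degree `d` Gröbner fan `GF(I)_d`: the set of the closures of the equivalence classes. -/
def groebnerFan (I : Ideal (MvPolynomial (Fin 3) K)) (d : ℕ) : Set (Set (Fin 3 → ℝ)) :=
  Set.range fun ω => closure (groebnerClass I d ω)

/-- `N(d)`: the sets of `d + 1` exponents of monomials of degree `d`. -/
def indexSets (d : ℕ) : Set (Finset (Fin 3 →₀ ℕ)) :=
  {J | (∀ ν ∈ J, ν.degree = d) ∧ J.card = d + 1}

/-- `m_J`, the sum of the exponents in `J`. -/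
def expSum (J : Finset (Fin 3 →₀ ℕ)) : Fin 3 →₀ ℕ := ∑ ν ∈ J, ν

/-- The Plücker coordinate at `J` of a subspace `W` of `K[x,y,z]`, computed in a basis `b` of `W`:
the maximal minor, with columns indexed by `J`, of the matrix of coefficients of `b`.
(The basis is indexed by `J` itself to fix an order of rows and columns, on which only the sign
depends.) -/
def pluckerCoord {W : Submodule K (MvPolynomial (Fin 3) K)} (J : Finset (Fin 3 →₀ ℕ))
    (b : Module.Basis J K W) : K :=
  Matrix.det (Matrix.of fun (i : J) (ν : J) => coeff ν.1 (b i : MvPolynomial (Fin 3) K))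

/-- Whether a Plücker coordinate vanishes does not depend on the basis. -/
theorem pluckerCoord_ne_zero_iff {W : Submodule K (MvPolynomial (Fin 3) K)}
    (J : Finset (Fin 3 →₀ ℕ)) (b b' : Module.Basis J K W) :
    pluckerCoord J b ≠ 0 ↔ pluckerCoord J b' ≠ 0 := by
  have key : ∀ c c' : Module.Basis J K W, pluckerCoord J c' ≠ 0 → pluckerCoord J c ≠ 0 := by
    intro c c' h h0
    apply h
    have hmul : (Matrix.of fun (i : J) (ν : J) => coeff ν.1 (c' i : MvPolynomial (Fin 3) K))
        = Matrix.of (fun (i : J) (k : J) => c.repr (c' i) k) *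
          Matrix.of fun (i : J) (ν : J) => coeff ν.1 (c i : MvPolynomial (Fin 3) K) := by
      ext i ν
      have hsum := congrArg (fun w : W => coeff ν.1 (w : MvPolynomial (Fin 3) K))
        (c.sum_repr (c' i))
      simp only [Submodule.coe_sum, Submodule.coe_smul, coeff_sum, coeff_smul, smul_eq_mul] at hsum
      simp only [Matrix.mul_apply, Matrix.of_apply]
      exact hsum.symm
    unfold pluckerCoord at h0 ⊢
    rw [hmul, Matrix.det_mul, h0, mul_zero]
  exact ⟨key b' b, key b b'⟩

/-- `N(I,d)`: the `J ∈ N(d)` at which the Plücker coordinate of `I_d` is nonzero. -/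
def pluckerSupport (I : Ideal (MvPolynomial (Fin 3) K)) (d : ℕ) : Set (Finset (Fin 3 →₀ ℕ)) :=
  {J | J ∈ indexSets d ∧ ∃ b : Module.Basis J K (degPart I d), pluckerCoord J b ≠ 0}

/-- `M(I,d)`: the vectors `m_J` with `J ∈ N(I,d)`. -/
def expSums (I : Ideal (MvPolynomial (Fin 3) K)) (d : ℕ) : Set (Fin 3 →₀ ℕ) :=
  expSum '' pluckerSupport I d

/-- `{ω ∈ ℝ³ : ω · m ≤ ω · m' for all m' ∈ M}`. -/
def minCone (M : Set (Fin 3 →₀ ℕ)) (m : Fin 3 →₀ ℕ) : Set (Fin 3 → ℝ) :=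
  {ω | ∀ m' ∈ M, wt ω m ≤ wt ω m'}

/-- The ideal `g(I)`, for the coordinate change `x_i ↦ ∑ j, g_ij x_j`. -/
def coordChange (g : GL (Fin 3) K) (I : Ideal (MvPolynomial (Fin 3) K)) :
    Ideal (MvPolynomial (Fin 3) K) :=
  I.map (aeval fun i : Fin 3 =>
    (∑ j : Fin 3, C (g.val i j) * X j : MvPolynomial (Fin 3) K)).toRingHom

/-- A subset of `GL₃(K)` is Zariski-open if it is the set of the matrices at which at least one
member of some set of polynomials in the nine entries does not vanish. -/
def IsZariskiOpen (U : Set (GL (Fin 3) K)) : Prop :=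
  ∃ P : Set (MvPolynomial (Fin 3 × Fin 3) K),
    U = {g | ∃ p ∈ P, eval (fun ij : Fin 3 × Fin 3 => g.val ij.1 ij.2) p ≠ 0}

/-- A property holds for generic `g ∈ GL₃(K)` if it holds on a nonempty Zariski-open set. -/
def Generically (p : GL (Fin 3) K → Prop) : Prop :=
  ∃ U : Set (GL (Fin 3) K), IsZariskiOpen U ∧ U.Nonempty ∧ ∀ g ∈ U, p g

/-- The degree `d` generic Gröbner fan: the cones that belong to `GF(g(I))_d` for generic `g`. -/
def genericGroebnerFan (I : Ideal (MvPolynomial (Fin 3) K)) (d : ℕ) : Set (Set (Fin 3 → ℝ)) :=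
  {C | Generically fun g => C ∈ groebnerFan (coordChange g I) d}

/-- `gN(I,d)`: the `J ∈ N(d)` at which the Plücker coordinate of `g(I)_d` is nonzero for
generic `g`. -/
def genericPluckerSupport (I : Ideal (MvPolynomial (Fin 3) K)) (d : ℕ) :
    Set (Finset (Fin 3 →₀ ℕ)) :=
  {J | Generically fun g => J ∈ pluckerSupport (coordChange g I) d}

/-- `gM(I,d)`: the vectors `m_J` with `J ∈ gN(I,d)`. -/
def genericExpSums (I : Ideal (MvPolynomial (Fin 3) K)) (d : ℕ) : Set (Fin 3 →₀ ℕ) :=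
  expSum '' genericPluckerSupport I d

/-- The maximal cones (with respect to inclusion) of a fan. -/
def maximalCones (F : Set (Set (Fin 3 → ℝ))) : Set (Set (Fin 3 → ℝ)) :=
  {C | Maximal (fun D => D ∈ F) C}

end GenericGroebner

end

noncomputable section

namespace GenericGroebner

open MvPolynomial

variable {K : Type*} [Field K]

/-! Put `W = I_d`. The Plücker coordinate at `J` is nonzero exactly when no nonzero element of `W`
has all its coefficients on `J` zero (`IsTransversal`); such `J` are the bases of a matroid.

Given `ω`, take a transversal `J` of least weight and the reduced echelon basis `f_ν` of `W` with
pivots `J`. If `μ` occurs in `f_ν`, exchanging `ν` for `μ` in `J` gives another transversal, so `μ`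
weighs at least as much as `ν`. Hence the initial forms of the `f_ν` are an echelon basis of the
initial space, and its nonzero Plücker coordinates sit exactly at the transversals of least weight
(`transversals_initialSpace`). So two weights are equivalent iff they have the same minimisers
(`initialSpace_eq_iff`).

The fan is therefore that of a linear minimisation problem over the finite set of the `m_J`: the
closure of a class consists of the weights at which all its minimisers stay minimal
(`closure_minWeight_eq`). At a maximal cone, perturbing `ω` along each coordinate axis shows that
all minimisers have one exponent sum `m` (`expSum_eq_of_maximal`). This `m` cuts out the cone, which
gives existence, uniqueness and injectivity.

In generic coordinates each Plücker coordinate is a polynomial in the entries of `g`. Finitely many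
`J` matter and `K` is infinite, so the support is generically constant; the fan depends on the
support alone. -/

theorem wt_eq_weight (ω : Fin 3 → ℝ) (m : Fin 3 →₀ ℕ) : wt ω m = Finsupp.weight ω m := by
  rw [wt, Finsupp.weight_apply, Finsupp.sum_fintype _ _ (by simp)]
  simp [mul_comm]

theorem wt_add (ω : Fin 3 → ℝ) (m n : Fin 3 →₀ ℕ) : wt ω (m + n) = wt ω m + wt ω n := by
  simp [wt_eq_weight]

theorem wt_expSum (ω : Fin 3 → ℝ) (J : Finset (Fin 3 →₀ ℕ)) :
    wt ω (expSum J) = ∑ ν ∈ J, wt ω ν := by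
  simp [wt_eq_weight, expSum, map_sum]

theorem wt_add_smul (ω η : Fin 3 → ℝ) (t : ℝ) (m : Fin 3 →₀ ℕ) :
    wt (ω + t • η) m = wt ω m + t * wt η m := by
  simp only [wt, Pi.add_apply, Pi.smul_apply, smul_eq_mul, Finset.mul_sum,
    ← Finset.sum_add_distrib]
  exact Finset.sum_congr rfl fun i _ => by ring

theorem continuous_wt (m : Fin 3 →₀ ℕ) : Continuous fun ω : Fin 3 → ℝ => wt ω m := by
  unfold wt
  fun_prop

/-! ### Initial forms -/

theorem coeff_weightedComponent (ω : Fin 3 → ℝ) (w : ℝ) (f : MvPolynomial (Fin 3) K)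
    (μ : Fin 3 →₀ ℕ) :
    coeff μ (weightedHomogeneousComponent ω w f) = if wt ω μ = w then coeff μ f else 0 := by
  rw [coeff_weightedHomogeneousComponent, wt_eq_weight]

theorem initialForm_zero (ω : Fin 3 → ℝ) :
    initialForm ω (0 : MvPolynomial (Fin 3) K) = 0 := by
  simp [initialForm]

theorem initialForm_eq {ω : Fin 3 → ℝ} {f : MvPolynomial (Fin 3) K} {ν : Fin 3 →₀ ℕ}
    (hν : coeff ν f ≠ 0) (hmin : ∀ μ, coeff μ f ≠ 0 → wt ω ν ≤ wt ω μ) :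
    initialForm ω f = weightedHomogeneousComponent ω (wt ω ν) f := by
  classical
  ext μ
  rw [coeff_weightedComponent, initialForm, coeff_sum]
  simp only [coeff_monomial, Finset.sum_ite_eq', Finset.mem_filter, mem_support_iff]
  by_cases h0 : coeff μ f = 0
  · simp [h0]
  · refine if_congr ⟨fun h => le_antisymm (h.2 ν hν) (hmin μ h0), fun h => ⟨h0, fun κ hκ => ?_⟩⟩
      rfl rfl
    rw [h]
    exact hmin κ hκ

theorem exists_min_weight (ω : Fin 3 → ℝ) {f : MvPolynomial (Fin 3) K} (hf : f ≠ 0) :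
    ∃ ν, coeff ν f ≠ 0 ∧ ∀ μ, coeff μ f ≠ 0 → wt ω ν ≤ wt ω μ := by
  obtain ⟨ν, hν, h⟩ := f.support.exists_min_image (wt ω) (support_nonempty.2 hf)
  exact ⟨ν, mem_support_iff.1 hν, fun μ hμ => h μ (mem_support_iff.2 hμ)⟩

theorem coeff_initialForm_ne_zero {ω : Fin 3 → ℝ} {f : MvPolynomial (Fin 3) K}
    {μ : Fin 3 →₀ ℕ} (h : coeff μ (initialForm ω f) ≠ 0) : coeff μ f ≠ 0 := by
  rcases eq_or_ne f 0 with rfl | hf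
  · simp [initialForm_zero] at h
  · obtain ⟨ν, hν, hmin⟩ := exists_min_weight ω hf
    rw [initialForm_eq hν hmin, coeff_weightedComponent] at h
    exact fun h0 => h (by simp [h0])

theorem isHomogeneous_initialForm (ω : Fin 3 → ℝ) {f : MvPolynomial (Fin 3) K} {e : ℕ}
    (hf : f.IsHomogeneous e) : (initialForm ω f).IsHomogeneous e :=
  fun _ hμ => hf (coeff_initialForm_ne_zero hμ)

theorem initialForm_monomial_mul (ω : Fin 3 → ℝ) (a : Fin 3 →₀ ℕ) (f : MvPolynomial (Fin 3) K) :
    initialForm ω (monomial a 1 * f) = monomial a 1 * initialForm ω f := by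
  rcases eq_or_ne f 0 with rfl | hf
  · simp [initialForm_zero]
  obtain ⟨ν, hν, hmin⟩ := exists_min_weight ω hf
  have h1 : coeff (a + ν) (monomial a 1 * f) ≠ 0 := by simpa using hν
  have h2 : ∀ μ, coeff μ (monomial a 1 * f) ≠ 0 → wt ω (a + ν) ≤ wt ω μ := by
    intro μ hμ
    rw [coeff_monomial_mul'] at hμ
    split_ifs at hμ with hle
    · obtain ⟨κ, rfl⟩ := exists_add_of_le hle
      rw [wt_add, wt_add]
      have := hmin κ (by simpa using hμ)
      linarith
    · exact absurd rfl hμ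
  rw [initialForm_eq h1 h2, initialForm_eq hν hmin]
  ext μ
  rw [coeff_weightedComponent, coeff_monomial_mul', coeff_monomial_mul', coeff_weightedComponent]
  by_cases hle : a ≤ μ
  · obtain ⟨κ, rfl⟩ := exists_add_of_le hle
    simp [wt_add]
  · simp [hle]

/-- The least weight of `f` may not be attained in degree `e`, whence the first alternative; if it
is attained there, `f` and its component share it. -/
theorem homogeneousComponent_initialForm (ω : Fin 3 → ℝ) (f : MvPolynomial (Fin 3) K) (e : ℕ) :
    homogeneousComponent e (initialForm ω f) = 0 ∨
      homogeneousComponent e (initialForm ω f) = initialForm ω (homogeneousComponent e f) := by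
  classical
  rcases eq_or_ne (homogeneousComponent e (initialForm ω f)) 0 with h0 | h0
  · exact Or.inl h0
  right
  obtain ⟨κ, hκ⟩ := ne_zero_iff.1 h0
  rw [coeff_homogeneousComponent] at hκ
  split_ifs at hκ with hdeg
  swap
  · exact absurd rfl hκ
  rcases eq_or_ne f 0 with rfl | hf
  · simp [initialForm_zero] at h0
  obtain ⟨ν, hν, hmin⟩ := exists_min_weight ω hf
  have hκ' := coeff_initialForm_ne_zero hκ
  rw [initialForm_eq hν hmin, coeff_weightedComponent] at hκ
  have hw : wt ω κ = wt ω ν := by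
    by_contra h
    simp [h] at hκ
  have hmin' : ∀ μ, coeff μ (homogeneousComponent e f) ≠ 0 → wt ω κ ≤ wt ω μ := by
    intro μ hμ
    rw [coeff_homogeneousComponent] at hμ
    rw [hw]
    exact hmin μ fun h => hμ (by simp [h])
  rw [initialForm_eq (by simpa [coeff_homogeneousComponent, hdeg] using hκ') hmin',
    initialForm_eq hν hmin, hw]
  ext μ
  simp only [coeff_homogeneousComponent, coeff_weightedComponent]
  split_ifs <;> rfl

/-! ### From the initial ideal to the initial space in one degree -/

/-- The span of the initial forms of the elements of a subspace. -/
def initialSpace (ω : Fin 3 → ℝ) (W : Submodule K (MvPolynomial (Fin 3) K)) :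
    Submodule K (MvPolynomial (Fin 3) K) :=
  Submodule.span K (initialForm ω '' W)

theorem mem_degPart {I : Ideal (MvPolynomial (Fin 3) K)} {d : ℕ} {f : MvPolynomial (Fin 3) K} :
    f ∈ degPart I d ↔ f ∈ I ∧ f.IsHomogeneous d :=
  Iff.rfl

theorem isGradedIdeal_iff {I : Ideal (MvPolynomial (Fin 3) K)} :
    IsGradedIdeal I ↔ ∀ e, ∀ f ∈ I, homogeneousComponent e f ∈ I := by
  constructor
  · intro h e f hf
    have := h e hf
    exact (decomposition.decompose'_apply f e) ▸ this
  · intro h e f hf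
    have := h e f hf
    exact (decomposition.decompose'_apply f e).symm ▸ this

/-- Initial forms commute with multiplication by monomials, so the span is already closed under
multiplication. Gradedness allows each `f` to be replaced by its homogeneous components. -/
theorem initialIdeal_le_span (ω : Fin 3 → ℝ) {I : Ideal (MvPolynomial (Fin 3) K)}
    (hI : IsGradedIdeal I) {h : MvPolynomial (Fin 3) K} (hh : h ∈ initialIdeal ω I) :
    h ∈ Submodule.span K (initialForm ω '' {f | f ∈ I ∧ ∃ e, f.IsHomogeneous e}) := by
  set T := Submodule.span K (initialForm ω '' {f | f ∈ I ∧ ∃ e, f.IsHomogeneous e}) with hT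
  have hmono : ∀ a : Fin 3 →₀ ℕ, ∀ p ∈ T, monomial a 1 * p ∈ T := by
    intro a p hp
    induction hp using Submodule.span_induction with
    | mem x hx =>
      obtain ⟨f, ⟨hfI, e, hfe⟩, rfl⟩ := hx
      rw [← initialForm_monomial_mul]
      exact Submodule.subset_span ⟨_, ⟨I.mul_mem_left _ hfI, _,
        (isHomogeneous_monomial (1 : K) rfl).mul hfe⟩, rfl⟩
    | zero => simp
    | add x y _ _ hx hy =>
      rw [mul_add]
      exact T.add_mem hx hy
    | smul c x _ hx =>
      rw [mul_smul_comm]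
      exact T.smul_mem c hx
  have hmul : ∀ q : MvPolynomial (Fin 3) K, ∀ p ∈ T, q * p ∈ T := by
    intro q p hp
    induction q using MvPolynomial.induction_on' with
    | monomial a c =>
      have : monomial a c * p = c • (monomial a 1 * p) := by
        rw [← smul_mul_assoc, smul_monomial, smul_eq_mul, mul_one]
      rw [this]
      exact T.smul_mem c (hmono a p hp)
    | add x y hx hy =>
      rw [add_mul]
      exact T.add_mem hx hy
  induction hh using Submodule.span_induction with
  | mem x hx =>
    obtain ⟨f, hf, rfl⟩ := hx
    rw [← sum_homogeneousComponent (initialForm ω f)]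
    refine T.sum_mem fun e _ => ?_
    rcases homogeneousComponent_initialForm ω f e with h0 | h1
    · rw [h0]
      exact T.zero_mem
    · rw [h1]
      exact Submodule.subset_span ⟨_, ⟨isGradedIdeal_iff.1 hI e f hf, e,
        homogeneousComponent_isHomogeneous e f⟩, rfl⟩
  | zero => exact T.zero_mem
  | add x y _ _ hx hy => exact T.add_mem hx hy
  | smul q x _ hx => exact hmul q x hx

theorem degPart_initialIdeal (ω : Fin 3 → ℝ) {I : Ideal (MvPolynomial (Fin 3) K)}
    (hI : IsGradedIdeal I) (d : ℕ) :
    degPart (initialIdeal ω I) d = initialSpace ω (degPart I d) := by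
  apply le_antisymm
  · intro h hh
    obtain ⟨hhI, hhd⟩ := mem_degPart.1 hh
    have hspan := initialIdeal_le_span ω hI hhI
    have key : ∀ p ∈ Submodule.span K (initialForm ω '' {f | f ∈ I ∧ ∃ e, f.IsHomogeneous e}),
        homogeneousComponent d p ∈ initialSpace ω (degPart I d) := by
      intro p hp
      induction hp using Submodule.span_induction with
      | mem x hx =>
        obtain ⟨f, ⟨hfI, e, hfe⟩, rfl⟩ := hx
        rw [homogeneousComponent_of_mem (isHomogeneous_initialForm ω hfe)]
        split_ifs with hde
        · subst hde
          exact Submodule.subset_span ⟨f, ⟨hfI, hfe⟩, rfl⟩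
        · exact Submodule.zero_mem _
      | zero => simp
      | add x y _ _ hx hy =>
        rw [map_add]
        exact Submodule.add_mem _ hx hy
      | smul c x _ hx =>
        rw [map_smul]
        exact Submodule.smul_mem _ c hx
    have := key h hspan
    rwa [homogeneousComponent_of_mem hhd, if_pos rfl] at this
  · refine Submodule.span_le.2 ?_
    rintro _ ⟨f, hf, rfl⟩
    exact ⟨Ideal.subset_span ⟨f, hf.1, rfl⟩, isHomogeneous_initialForm ω hf.2⟩

/-! ### Transversals and echelon bases -/

/-- The determinant of the part of weight zero of a matrix whose nonzero entries have nonnegative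
weight. -/
theorem det_of_weight_eq {ι R : Type*} [Fintype ι] [DecidableEq ι] [CommRing R]
    (A : Matrix ι ι R) (a b : ι → ℝ) (hA : ∀ i j, A i j ≠ 0 → a i ≤ b j) :
    (Matrix.of fun i j => if b j = a i then A i j else 0).det =
      if ∑ j, b j = ∑ i, a i then A.det else 0 := by
  have hterm : ∀ σ : Equiv.Perm ι, (∏ i, if b i = a (σ i) then A (σ i) i else 0) =
      if ∑ j, b j = ∑ i, a i then ∏ i, A (σ i) i else 0 := by
    intro σ
    have hsum : ∑ i, a (σ i) = ∑ i, a i := Equiv.sum_comp σ a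
    -- In a nonzero term every factor has `a (σ j) ≤ b j`, so equality of the sums forces equality
    -- in each factor.
    by_cases hall : ∀ i, b i = a (σ i)
    · have : ∑ j, b j = ∑ i, a i := by rw [← hsum]; exact Finset.sum_congr rfl fun i _ => hall i
      rw [if_pos this]
      exact Finset.prod_congr rfl fun i _ => if_pos (hall i)
    · push Not at hall
      obtain ⟨i, hi⟩ := hall
      rw [Finset.prod_eq_zero (Finset.mem_univ i) (if_neg hi)]
      split_ifs with h
      · by_contra hne
        have hle : ∀ j ∈ Finset.univ, a (σ j) ≤ b j := fun j hj =>
          hA _ _ fun h0 => hne (Finset.prod_eq_zero (f := fun i => A (σ i) i) hj h0).symm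
        have := (Finset.sum_eq_sum_iff_of_le hle).1 (hsum.trans h.symm) i (Finset.mem_univ i)
        exact hi this.symm
      · rfl
  rw [Matrix.det_apply, Matrix.det_apply]
  simp only [Matrix.of_apply, hterm]
  split_ifs <;> simp

/-- No nonzero element of `W` vanishes at all coefficients indexed by `J`. -/
def IsTransversal (W : Submodule K (MvPolynomial (Fin 3) K)) (J : Finset (Fin 3 →₀ ℕ)) : Prop :=
  ∀ f ∈ W, (∀ ν ∈ J, coeff ν f = 0) → f = 0

/-- A combination of the `f i` that vanishes on `J` is a vector in the left kernel of the matrix. -/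
theorem isTransversal_iff_det_ne_zero {ι : Type*} [Fintype ι] [DecidableEq ι]
    {f : ι → MvPolynomial (Fin 3) K} (hf : LinearIndependent K f) {J : Finset (Fin 3 →₀ ℕ)}
    (e : ι ≃ J) :
    IsTransversal (Submodule.span K (Set.range f)) J ↔
      (Matrix.of fun i j => coeff (e j).1 (f i)).det ≠ 0 := by
  have hcoeff : ∀ (v : ι → K) (j : ι),
      Matrix.vecMul v (Matrix.of fun i j => coeff (e j).1 (f i)) j =
        coeff (e j).1 (∑ i, v i • f i) := by
    intro v j
    simp [Matrix.vecMul, dotProduct, coeff_sum]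
  rw [ne_eq, ← Matrix.exists_vecMul_eq_zero_iff]
  push Not
  constructor
  · intro h v hv h0
    have hz := h (∑ i, v i • f i)
      (Submodule.sum_mem _ fun i _ => Submodule.smul_mem _ _ (Submodule.subset_span ⟨i, rfl⟩))
      fun ν hν => by
        have := congrFun h0 (e.symm ⟨ν, hν⟩)
        rw [hcoeff] at this
        simpa using this
    exact hv (funext (Fintype.linearIndependent_iff.1 hf v hz))
  · intro h p hp hJ
    obtain ⟨v, rfl⟩ := (Submodule.mem_span_range_iff_exists_fun K).1 hp
    by_cases hv : v = 0
    · simp [hv]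
    · refine absurd (funext fun j => ?_) (h v hv)
      rw [hcoeff]
      exact hJ _ (e j).2

/-- The family `f` in `W` is in reduced echelon form with respect to the pivots `J`. -/
structure IsEchelon (W : Submodule K (MvPolynomial (Fin 3) K)) (J : Finset (Fin 3 →₀ ℕ))
    (f : J → MvPolynomial (Fin 3) K) : Prop where
  mem : ∀ ν, f ν ∈ W
  coeff_self : ∀ ν : J, coeff ν.1 (f ν) = 1
  coeff_ne : ∀ ν μ : J, μ ≠ ν → coeff μ.1 (f ν) = 0

theorem IsTransversal.exists_isEchelon {W : Submodule K (MvPolynomial (Fin 3) K)}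
    {J : Finset (Fin 3 →₀ ℕ)} (h : IsTransversal W J) [FiniteDimensional K W]
    (hcard : Module.finrank K W = J.card) :
    ∃ f, IsEchelon W J f := by
  classical
  let L : W →ₗ[K] (J → K) := LinearMap.pi fun ν => (lcoeff K ν.1).comp W.subtype
  have hL : ∀ (w : W) (ν : J), L w ν = coeff ν.1 (w : MvPolynomial (Fin 3) K) := fun _ _ => rfl
  have hinj : Function.Injective L := by
    rw [injective_iff_map_eq_zero]
    intro w hw
    exact Subtype.ext (h w w.2 fun ν hν => by simpa [hL] using congrFun hw ⟨ν, hν⟩)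
  have hsurj : Function.Surjective L :=
    (LinearMap.injective_iff_surjective_of_finrank_eq_finrank (by simp [hcard])).1 hinj
  choose g hg using fun ν : J => hsurj (Pi.single ν 1)
  exact ⟨fun ν => g ν, fun ν => (g ν).2, fun ν => by rw [← hL, hg]; simp,
    fun ν μ hne => by rw [← hL, hg]; simp [hne]⟩

namespace IsEchelon

variable {W : Submodule K (MvPolynomial (Fin 3) K)} {J : Finset (Fin 3 →₀ ℕ)}
  {f : J → MvPolynomial (Fin 3) K}

theorem coeff_sum_smul (hf : IsEchelon W J f) (c : J → K) (ν : J) :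
    coeff ν.1 (∑ κ, c κ • f κ) = c ν := by
  rw [coeff_sum, Finset.sum_eq_single ν]
  · simp [hf.coeff_self]
  · intro κ _ hκ
    simp [hf.coeff_ne κ ν hκ.symm]
  · simp

theorem linearIndependent (hf : IsEchelon W J f) : LinearIndependent K f := by
  rw [Fintype.linearIndependent_iff]
  intro c hc ν
  rw [← hf.coeff_sum_smul c ν, hc, coeff_zero]

theorem eq_sum (hf : IsEchelon W J f) (hJ : IsTransversal W J) {p : MvPolynomial (Fin 3) K}
    (hp : p ∈ W) : p = ∑ κ, coeff κ.1 p • f κ := by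
  rw [← sub_eq_zero]
  refine hJ _ (W.sub_mem hp (W.sum_mem fun κ _ => W.smul_mem _ (hf.mem κ))) fun ν hν => ?_
  rw [coeff_sub, hf.coeff_sum_smul _ ⟨ν, hν⟩, sub_self]

theorem span_eq (hf : IsEchelon W J f) (hJ : IsTransversal W J) :
    Submodule.span K (Set.range f) = W := by
  apply le_antisymm
  · rw [Submodule.span_le]
    rintro _ ⟨ν, rfl⟩
    exact hf.mem ν
  · intro p hp
    rw [hf.eq_sum hJ hp]
    exact Submodule.sum_mem _ fun κ _ => Submodule.smul_mem _ _ (Submodule.subset_span ⟨κ, rfl⟩)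

open Classical in
-- An element that vanishes on `J` away from `ν` is a multiple of `f ν`; vanishing at `μ` then kills
-- the scalar.
theorem isTransversal_exchange (hf : IsEchelon W J f) (hJ : IsTransversal W J) {ν : J}
    {μ : Fin 3 →₀ ℕ} (hμ : coeff μ (f ν) ≠ 0) :
    IsTransversal W (insert μ (J.erase ν.1)) := by
  intro p hp h0
  have hexp : p = coeff ν.1 p • f ν := by
    conv_lhs => rw [hf.eq_sum hJ hp]
    refine Finset.sum_eq_single ν (fun κ _ hκ => ?_) (by simp)
    rw [h0 κ.1 (by simp [Subtype.coe_injective.ne hκ]), zero_smul]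
  have h1 : coeff ν.1 p * coeff μ (f ν) = 0 := by
    rw [← smul_eq_mul, ← coeff_smul, ← hexp]
    exact h0 μ (by simp)
  rw [hexp, (mul_eq_zero.1 h1).resolve_right hμ, zero_smul]

end IsEchelon

/-! ### Transversals of least weight and the initial space -/

/-- The sets of `d + 1` exponents of degree `d` that are transversal to `W`. -/
def transversals (W : Submodule K (MvPolynomial (Fin 3) K)) (d : ℕ) :
    Set (Finset (Fin 3 →₀ ℕ)) :=
  {J | J ∈ indexSets d ∧ IsTransversal W J}

/-- The members of `N` whose exponent sum has minimal `ω`-weight. -/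
def minWeight (ω : Fin 3 → ℝ) (N : Set (Finset (Fin 3 →₀ ℕ))) : Set (Finset (Fin 3 →₀ ℕ)) :=
  {J | J ∈ N ∧ ∀ J' ∈ N, wt ω (expSum J) ≤ wt ω (expSum J')}

theorem finite_indexSets (d : ℕ) : (indexSets d).Finite := by
  have hfin := Finsupp.finite_of_degree_eq (σ := Fin 3) d
  refine (hfin.toFinset.powerset.finite_toSet).subset fun J hJ => ?_
  simp only [Finset.coe_powerset, Set.mem_preimage, Set.mem_powerset_iff]
  intro ν hν
  simpa using hJ.1 ν hν

theorem minWeight_nonempty (ω : Fin 3 → ℝ) {N : Set (Finset (Fin 3 →₀ ℕ))} (hN : N.Finite)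
    (hne : N.Nonempty) : (minWeight ω N).Nonempty := by
  obtain ⟨J, hJ, h⟩ := Set.exists_min_image N (fun J => wt ω (expSum J)) hN hne
  exact ⟨J, hJ, h⟩

theorem finite_transversals (W : Submodule K (MvPolynomial (Fin 3) K)) (d : ℕ) :
    (transversals W d).Finite :=
  (finite_indexSets d).subset fun _ h => h.1

section Transversals

variable {W : Submodule K (MvPolynomial (Fin 3) K)} {d : ℕ}

/-- An inclusion-minimal transversal set of exponents has the right size: by minimality, restricting
coefficients to it is onto as well as injective. -/
theorem transversals_nonempty (hW : W ≤ homogeneousSubmodule (Fin 3) K d)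
    (hd : Module.finrank K W = d + 1) : (transversals W d).Nonempty := by
  classical
  have : FiniteDimensional K W := Module.finite_of_finrank_pos (by omega)
  let P : Finset (Fin 3 →₀ ℕ) → Prop := fun J => IsTransversal W J ∧ ∀ ν ∈ J, ν.degree = d
  have hex : ∃ J, P J := by
    refine ⟨(Finsupp.finite_of_degree_eq (σ := Fin 3) d).toFinset, fun f hf h0 => ?_, by simp⟩
    ext μ
    by_contra hμ
    have hdeg : μ.degree = d := by
      rw [Finsupp.degree_eq_weight_one]
      exact hW hf hμ
    exact hμ (by simpa using h0 μ (by simpa using hdeg))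
  obtain ⟨J, ⟨hJ, hJd⟩, hmin⟩ := exists_minimal_of_wellFoundedLT P hex
  refine ⟨J, ⟨hJd, ?_⟩, hJ⟩
  let L : W →ₗ[K] (J → K) := LinearMap.pi fun ν => (lcoeff K ν.1).comp W.subtype
  have hL : ∀ (w : W) (ν : J), L w ν = coeff ν.1 (w : MvPolynomial (Fin 3) K) := fun _ _ => rfl
  have hinj : Function.Injective L := by
    rw [injective_iff_map_eq_zero]
    intro w hw
    exact Subtype.ext (hJ w w.2 fun ν hν => by simpa [hL] using congrFun hw ⟨ν, hν⟩)
  have hsurj : Function.Surjective L := by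
    rw [← LinearMap.range_eq_top, eq_top_iff, ← (Pi.basisFun K J).span_eq, Submodule.span_le]
    rintro _ ⟨ν, rfl⟩
    -- Since removing `ν` destroys transversality, some `h` in `W` vanishes on the rest of `J` but
    -- not at `ν`; scaled, it maps to the unit vector at `ν`.
    have hnot : ¬ IsTransversal W (J.erase ν.1) := by
      intro ht
      have := hmin (y := J.erase ν.1) ⟨ht, fun κ hκ => hJd κ (Finset.mem_of_mem_erase hκ)⟩
        (Finset.erase_subset _ _) ν.2
      simp at this
    unfold IsTransversal at hnot
    push Not at hnot
    obtain ⟨h, hhW, hh0, hhne⟩ := hnot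
    have hc : coeff ν.1 h ≠ 0 := by
      intro hc
      refine hhne (hJ h hhW fun κ hκ => ?_)
      by_cases hκν : κ = ν.1
      · rw [hκν, hc]
      · exact hh0 κ (Finset.mem_erase.2 ⟨hκν, hκ⟩)
    refine ⟨(coeff ν.1 h)⁻¹ • ⟨h, hhW⟩, ?_⟩
    ext κ
    rw [map_smul, Pi.smul_apply, hL, Pi.basisFun_apply]
    by_cases hκν : κ = ν
    · subst hκν
      simp [hc]
    · rw [Pi.single_eq_of_ne hκν,
        hh0 κ.1 (Finset.mem_erase.2 ⟨Subtype.coe_injective.ne hκν, κ.2⟩), smul_zero]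
  have := (LinearEquiv.ofBijective L ⟨hinj, hsurj⟩).finrank_eq
  simp only [Module.finrank_fintype_fun_eq_card, Fintype.card_coe] at this
  omega

open Classical in
theorem exchange_mem_transversals (hW : W ≤ homogeneousSubmodule (Fin 3) K d)
    {J : Finset (Fin 3 →₀ ℕ)} (hJ : J ∈ transversals W d) {f : J → MvPolynomial (Fin 3) K}
    (hf : IsEchelon W J f) {ν : J} {μ : Fin 3 →₀ ℕ} (hμ : coeff μ (f ν) ≠ 0) (hμJ : μ ∉ J) :
    insert μ (J.erase ν.1) ∈ transversals W d := by
  have hdeg : μ.degree = d := by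
    rw [Finsupp.degree_eq_weight_one]
    exact hW (hf.mem ν) hμ
  refine ⟨⟨fun κ hκ => ?_, ?_⟩, hf.isTransversal_exchange hJ.2 hμ⟩
  · rcases Finset.mem_insert.1 hκ with rfl | h
    · exact hdeg
    · exact hJ.1.1 κ (Finset.mem_of_mem_erase h)
  · rw [Finset.card_insert_of_notMem fun h => hμJ (Finset.mem_of_mem_erase h),
      Finset.card_erase_add_one ν.2, hJ.1.2]

open Classical in
theorem wt_expSum_exchange (ω : Fin 3 → ℝ) {J : Finset (Fin 3 →₀ ℕ)} (ν : J)
    {μ : Fin 3 →₀ ℕ} (hμJ : μ ∉ J) :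
    wt ω (expSum (insert μ (J.erase ν.1))) + wt ω ν.1 = wt ω (expSum J) + wt ω μ := by
  rw [wt_expSum, wt_expSum, Finset.sum_insert fun h => hμJ (Finset.mem_of_mem_erase h),
    ← Finset.sum_erase_add _ _ ν.2]
  ring

theorem IsEchelon.eq_of_coeff_ne_zero {J : Finset (Fin 3 →₀ ℕ)}
    {f : J → MvPolynomial (Fin 3) K} (hf : IsEchelon W J f) {ν : J} {μ : Fin 3 →₀ ℕ}
    (hμ : coeff μ (f ν) ≠ 0) (hμJ : μ ∈ J) : μ = ν.1 := by
  by_contra hne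
  exact hμ (hf.coeff_ne ν ⟨μ, hμJ⟩ fun h => hne (congrArg Subtype.val h))

theorem wt_le_of_coeff_ne_zero (hW : W ≤ homogeneousSubmodule (Fin 3) K d) {ω : Fin 3 → ℝ}
    {J : Finset (Fin 3 →₀ ℕ)} (hJ : J ∈ minWeight ω (transversals W d))
    {f : J → MvPolynomial (Fin 3) K} (hf : IsEchelon W J f) {ν : J} {μ : Fin 3 →₀ ℕ}
    (hμ : coeff μ (f ν) ≠ 0) : wt ω ν.1 ≤ wt ω μ := by
  by_cases hμJ : μ ∈ J
  · rw [hf.eq_of_coeff_ne_zero hμ hμJ]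
  · have := hJ.2 _ (exchange_mem_transversals hW hJ.1 hf hμ hμJ)
    have := wt_expSum_exchange ω ν hμJ
    linarith

/-- A tie at `ω` makes the exchanged set minimal at `ω`, hence at `ω'`, where its weight must again
equal that of `J`. -/
theorem wt_eq_of_minWeight_eq (hW : W ≤ homogeneousSubmodule (Fin 3) K d) {ω ω' : Fin 3 → ℝ}
    {J : Finset (Fin 3 →₀ ℕ)} (hJ : J ∈ minWeight ω (transversals W d))
    (heq : minWeight ω (transversals W d) = minWeight ω' (transversals W d))
    {f : J → MvPolynomial (Fin 3) K} (hf : IsEchelon W J f) {ν : J} {μ : Fin 3 →₀ ℕ}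
    (hμ : coeff μ (f ν) ≠ 0) (hw : wt ω μ = wt ω ν.1) : wt ω' μ = wt ω' ν.1 := by
  classical
  by_cases hμJ : μ ∈ J
  · rw [hf.eq_of_coeff_ne_zero hμ hμJ]
  have hJ' := exchange_mem_transversals hW hJ.1 hf hμ hμJ
  have hmem : insert μ (J.erase ν.1) ∈ minWeight ω (transversals W d) := by
    refine ⟨hJ', fun J₂ hJ₂ => le_trans (le_of_eq ?_) (hJ.2 J₂ hJ₂)⟩
    have := wt_expSum_exchange ω ν hμJ
    linarith
  rw [heq] at hJ hmem
  have := hmem.2 J hJ.1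
  have := hJ.2 _ hJ'
  have := wt_expSum_exchange ω' ν hμJ
  linarith

theorem initialForm_echelon (hW : W ≤ homogeneousSubmodule (Fin 3) K d) {ω : Fin 3 → ℝ}
    {J : Finset (Fin 3 →₀ ℕ)} (hJ : J ∈ minWeight ω (transversals W d))
    {f : J → MvPolynomial (Fin 3) K} (hf : IsEchelon W J f) (ν : J) :
    initialForm ω (f ν) = weightedHomogeneousComponent ω (wt ω ν.1) (f ν) :=
  initialForm_eq (by simp [hf.coeff_self ν]) fun _ hμ => wt_le_of_coeff_ne_zero hW hJ hf hμ

theorem isEchelon_initialForm (hW : W ≤ homogeneousSubmodule (Fin 3) K d) {ω : Fin 3 → ℝ}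
    {J : Finset (Fin 3 →₀ ℕ)} (hJ : J ∈ minWeight ω (transversals W d))
    {f : J → MvPolynomial (Fin 3) K} (hf : IsEchelon W J f) :
    IsEchelon (initialSpace ω W) J fun ν => initialForm ω (f ν) where
  mem ν := Submodule.subset_span ⟨f ν, hf.mem ν, rfl⟩
  coeff_self ν := by
    rw [initialForm_echelon hW hJ hf, coeff_weightedComponent, if_pos rfl, hf.coeff_self]
  coeff_ne ν μ hne := by
    rw [initialForm_echelon hW hJ hf, coeff_weightedComponent, hf.coeff_ne ν μ hne, ite_self]

theorem initialSpace_eq_span (hW : W ≤ homogeneousSubmodule (Fin 3) K d) {ω : Fin 3 → ℝ}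
    {J : Finset (Fin 3 →₀ ℕ)} (hJ : J ∈ minWeight ω (transversals W d))
    {f : J → MvPolynomial (Fin 3) K} (hf : IsEchelon W J f) :
    initialSpace ω W = Submodule.span K (Set.range fun ν => initialForm ω (f ν)) := by
  apply le_antisymm
  · refine Submodule.span_le.2 ?_
    rintro _ ⟨p, hp, rfl⟩
    rcases eq_or_ne p 0 with rfl | hp0
    · rw [initialForm_zero]
      exact Submodule.zero_mem _
    obtain ⟨κ, hκ, hmin⟩ := exists_min_weight ω hp0
    rw [initialForm_eq hκ hmin]
    conv in weightedHomogeneousComponent _ _ _ => rw [hf.eq_sum hJ.1.2 hp]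
    rw [map_sum]
    refine Submodule.sum_mem _ fun ν _ => ?_
    rw [map_smul]
    by_cases hν : coeff ν.1 p = 0
    · rw [hν, zero_smul]
      exact Submodule.zero_mem _
    refine Submodule.smul_mem _ _ ?_
    -- In the least weight of `p`, `f ν` contributes its initial form if its pivot has that weight,
    -- and nothing if the pivot is heavier.
    rcases (hmin ν.1 hν).eq_or_lt with heq | hlt
    · rw [heq, ← initialForm_echelon hW hJ hf]
      exact Submodule.subset_span ⟨ν, rfl⟩
    · convert Submodule.zero_mem _
      ext μ
      rw [coeff_weightedComponent, coeff_zero]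
      split_ifs with h
      · by_contra hμ
        have := wt_le_of_coeff_ne_zero hW hJ hf hμ
        linarith
      · rfl
  · rw [Submodule.span_le]
    rintro _ ⟨ν, rfl⟩
    exact Submodule.subset_span ⟨f ν, hf.mem ν, rfl⟩

/-- Passing to initial forms keeps the entries of the echelon matrix whose column and pivot have
equal weight. By `det_of_weight_eq` a minor then survives iff its weight equals that of `J`. -/
theorem transversals_initialSpace (hW : W ≤ homogeneousSubmodule (Fin 3) K d)
    (hd : Module.finrank K W = d + 1) (ω : Fin 3 → ℝ) :
    transversals (initialSpace ω W) d = minWeight ω (transversals W d) := by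
  classical
  have : FiniteDimensional K W := Module.finite_of_finrank_pos (by omega)
  obtain ⟨J, hJ⟩ := minWeight_nonempty ω (finite_transversals W d) (transversals_nonempty hW hd)
  obtain ⟨f, hf⟩ := hJ.1.2.exists_isEchelon (hd.trans hJ.1.1.2.symm)
  ext J'
  by_cases hJ'd : J' ∈ indexSets d
  swap
  · exact ⟨fun h => absurd h.1 hJ'd, fun h => absurd h.1.1 hJ'd⟩
  let e : J ≃ J' := Finset.equivOfCardEq (hJ.1.1.2.trans hJ'd.2.symm)
  have h1 := isTransversal_iff_det_ne_zero (isEchelon_initialForm hW hJ hf).linearIndependent e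
  have h2 := isTransversal_iff_det_ne_zero hf.linearIndependent e
  rw [← initialSpace_eq_span hW hJ hf] at h1
  rw [hf.span_eq hJ.1.2] at h2
  have hdet := det_of_weight_eq (Matrix.of fun i j : J => coeff (e j).1 (f i))
    (fun i => wt ω i.1) (fun j => wt ω (e j).1)
    fun i j hij => wt_le_of_coeff_ne_zero hW hJ hf hij
  have hmat : (Matrix.of fun i j : J => coeff (e j).1 (initialForm ω (f i))) =
      Matrix.of fun i j : J => if wt ω (e j).1 = wt ω i.1 then
        (Matrix.of fun i j : J => coeff (e j).1 (f i)) i j else 0 := by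
    ext i j
    simp only [Matrix.of_apply]
    rw [initialForm_echelon hW hJ hf, coeff_weightedComponent]
  have hs : ∑ j : J, wt ω (e j).1 = wt ω (expSum J') := by
    rw [wt_expSum, Equiv.sum_comp e fun μ : J' => wt ω μ.1]
    exact Finset.sum_coe_sort J' (wt ω)
  have hs' : ∑ j : J, wt ω j.1 = wt ω (expSum J) := by
    rw [wt_expSum]
    exact Finset.sum_coe_sort J (wt ω)
  rw [hmat, hdet, hs, hs'] at h1
  constructor
  · intro h
    have h3 := h1.1 h.2
    split_ifs at h3 with hw
    · exact ⟨⟨hJ'd, h2.2 h3⟩, fun J₂ hJ₂ => hw.le.trans (hJ.2 J₂ hJ₂)⟩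
    · exact absurd rfl h3
  · intro h
    refine ⟨hJ'd, h1.2 ?_⟩
    rw [if_pos (le_antisymm (h.2 J hJ.1) (hJ.2 J' h.1))]
    exact h2.1 h.1.2

/-- The initial space determines its transversals, which are the minimisers. Conversely, a common
minimiser gives one echelon basis for both weights, and equal minimisers mean equal ties, so its
initial forms agree. -/
theorem initialSpace_eq_iff (hW : W ≤ homogeneousSubmodule (Fin 3) K d)
    (hd : Module.finrank K W = d + 1) (ω ω' : Fin 3 → ℝ) :
    initialSpace ω W = initialSpace ω' W ↔
      minWeight ω (transversals W d) = minWeight ω' (transversals W d) := by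
  constructor
  · intro h
    rw [← transversals_initialSpace hW hd, h, transversals_initialSpace hW hd]
  · intro h
    have : FiniteDimensional K W := Module.finite_of_finrank_pos (by omega)
    obtain ⟨J, hJ⟩ := minWeight_nonempty ω (finite_transversals W d) (transversals_nonempty hW hd)
    have hJ' := h ▸ hJ
    obtain ⟨f, hf⟩ := hJ.1.2.exists_isEchelon (hd.trans hJ.1.1.2.symm)
    rw [initialSpace_eq_span hW hJ hf, initialSpace_eq_span hW hJ' hf]
    congr 2
    ext ν μ
    rw [initialForm_echelon hW hJ hf, initialForm_echelon hW hJ' hf, coeff_weightedComponent,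
      coeff_weightedComponent]
    by_cases hμ : coeff μ (f ν) = 0
    · simp [hμ]
    exact if_congr ⟨wt_eq_of_minWeight_eq hW hJ h hf hμ,
      wt_eq_of_minWeight_eq hW hJ' h.symm hf hμ⟩ rfl rfl

end Transversals

/-! ### The Gröbner fan as a set of face cones -/

section Fan

theorem degPart_le_homogeneousSubmodule (I : Ideal (MvPolynomial (Fin 3) K)) (d : ℕ) :
    degPart I d ≤ homogeneousSubmodule (Fin 3) K d :=
  inf_le_right

theorem pluckerCoord_ne_zero_iff_isTransversal {W : Submodule K (MvPolynomial (Fin 3) K)}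
    {J : Finset (Fin 3 →₀ ℕ)} (b : Module.Basis J K W) :
    pluckerCoord J b ≠ 0 ↔ IsTransversal W J := by
  have hli : LinearIndependent K fun i => (b i : MvPolynomial (Fin 3) K) :=
    b.linearIndependent.map' W.subtype W.ker_subtype
  have hspan : Submodule.span K (Set.range fun i => (b i : MvPolynomial (Fin 3) K)) = W := by
    have : (Set.range fun i => (b i : MvPolynomial (Fin 3) K)) = W.subtype '' Set.range b := by
      rw [← Set.range_comp]
      rfl
    rw [this, Submodule.span_image, b.span_eq, Submodule.map_top, Submodule.range_subtype]
  have h := isTransversal_iff_det_ne_zero hli (Equiv.refl J)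
  rw [hspan] at h
  exact h.symm

variable {I : Ideal (MvPolynomial (Fin 3) K)} {d : ℕ}

theorem pluckerSupport_eq_transversals (hd : Module.finrank K (degPart I d) = d + 1) :
    pluckerSupport I d = transversals (degPart I d) d := by
  have : FiniteDimensional K (degPart I d) := Module.finite_of_finrank_pos (by omega)
  ext J
  refine and_congr_right fun hJ => ⟨?_, fun h => ?_⟩
  · rintro ⟨b, hb⟩
    exact (pluckerCoord_ne_zero_iff_isTransversal b).1 hb
  · let b := (Module.finBasisOfFinrankEq K _ hd).reindex
      (Fintype.equivOfCardEq (by rw [Fintype.card_fin, Fintype.card_coe, hJ.2]) : Fin (d + 1) ≃ J)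
    exact ⟨b, (pluckerCoord_ne_zero_iff_isTransversal b).2 h⟩

theorem mem_groebnerClass_iff (hI : IsGradedIdeal I)
    (hd : Module.finrank K (degPart I d) = d + 1) {ω ω' : Fin 3 → ℝ} :
    ω' ∈ groebnerClass I d ω ↔
      minWeight ω' (pluckerSupport I d) = minWeight ω (pluckerSupport I d) := by
  rw [groebnerClass, Set.mem_ofPred_eq, degPart_initialIdeal _ hI, degPart_initialIdeal _ hI,
    initialSpace_eq_iff (degPart_le_homogeneousSubmodule I d) hd,
    pluckerSupport_eq_transversals hd]

/-- Some set is minimal for both summands, so minimising the sum means minimising both. Thus `t`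
need not be small. -/
theorem minWeight_add_smul {N : Set (Finset (Fin 3 →₀ ℕ))} {ω ω' : Fin 3 → ℝ}
    (hne : (minWeight ω N).Nonempty) (hsub : minWeight ω N ⊆ minWeight ω' N) {t : ℝ}
    (ht : 0 < t) : minWeight (ω' + t • ω) N = minWeight ω N := by
  ext J
  constructor
  · rintro ⟨hJ, hmin⟩
    refine ⟨hJ, fun J' hJ' => ?_⟩
    obtain ⟨J₀, hJ₀⟩ := hne
    have h1 := hmin J₀ hJ₀.1
    rw [wt_add_smul, wt_add_smul] at h1
    have h2 := (hsub hJ₀).2 J hJ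
    have h3 : t * wt ω (expSum J) ≤ t * wt ω (expSum J₀) := by linarith
    exact (le_of_mul_le_mul_left h3 ht).trans (hJ₀.2 J' hJ')
  · intro hJ
    refine ⟨hJ.1, fun J' hJ' => ?_⟩
    rw [wt_add_smul, wt_add_smul]
    exact add_le_add ((hsub hJ).2 J' hJ') (mul_le_mul_of_nonneg_left (hJ.2 J' hJ') ht.le)

/-- The set of weights at which all members of `minWeight ω N` are minimal. -/
def faceCone (N : Set (Finset (Fin 3 →₀ ℕ))) (ω : Fin 3 → ℝ) : Set (Fin 3 → ℝ) :=
  {ω' | minWeight ω N ⊆ minWeight ω' N}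

theorem isClosed_faceCone (N : Set (Finset (Fin 3 →₀ ℕ))) (ω : Fin 3 → ℝ) :
    IsClosed (faceCone N ω) := by
  have : faceCone N ω = ⋂ J ∈ minWeight ω N, ⋂ J' ∈ N,
      {ω' | wt ω' (expSum J) ≤ wt ω' (expSum J')} := by
    ext ω'
    simp only [faceCone, Set.mem_ofPred_eq, Set.mem_iInter]
    exact ⟨fun h J hJ J' hJ' => (h hJ).2 J' hJ', fun h J hJ => ⟨hJ.1, h J hJ⟩⟩
  rw [this]
  exact isClosed_biInter fun J _ => isClosed_biInter fun J' _ =>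
    isClosed_le (continuous_wt _) (continuous_wt _)

/-- The face cone is closed and contains the class; each `ω'` in it is the limit of the class
members `ω' + t • ω` as `t` decreases to `0`. -/
theorem closure_minWeight_eq {N : Set (Finset (Fin 3 →₀ ℕ))} {ω : Fin 3 → ℝ}
    (hne : (minWeight ω N).Nonempty) :
    closure {ω' | minWeight ω' N = minWeight ω N} = faceCone N ω := by
  apply subset_antisymm
  · exact closure_minimal (fun ω' h => (Set.mem_ofPred_eq ▸ h : _ = _).ge)
      (isClosed_faceCone N ω)
  · intro ω' hω'
    have hlim : Filter.Tendsto (fun t : ℝ => ω' + t • ω) (nhdsWithin 0 (Set.Ioi 0)) (nhds ω') := by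
      have hc : Continuous fun t : ℝ => ω' + t • ω := by fun_prop
      have := hc.tendsto 0
      simp only [zero_smul, add_zero] at this
      exact this.mono_left nhdsWithin_le_nhds
    refine mem_closure_of_tendsto hlim ?_
    filter_upwards [self_mem_nhdsWithin] with t ht
    exact minWeight_add_smul hne hω' ht

theorem finite_pluckerSupport (I : Ideal (MvPolynomial (Fin 3) K)) (d : ℕ) :
    (pluckerSupport I d).Finite :=
  (finite_indexSets d).subset fun _ h => h.1

theorem pluckerSupport_nonempty (hd : Module.finrank K (degPart I d) = d + 1) :
    (pluckerSupport I d).Nonempty := by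
  rw [pluckerSupport_eq_transversals hd]
  exact transversals_nonempty (degPart_le_homogeneousSubmodule I d) hd

theorem groebnerFan_eq (hI : IsGradedIdeal I) (hd : Module.finrank K (degPart I d) = d + 1) :
    groebnerFan I d = Set.range (faceCone (pluckerSupport I d)) := by
  unfold groebnerFan
  congr 1
  funext ω
  rw [← closure_minWeight_eq
    (minWeight_nonempty ω (finite_pluckerSupport I d) (pluckerSupport_nonempty hd))]
  congr 1
  ext ω'
  exact mem_groebnerClass_iff hI hd

theorem eventually_minWeight_subset {N : Set (Finset (Fin 3 →₀ ℕ))} (hN : N.Finite)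
    (ω : Fin 3 → ℝ) : ∀ᶠ ω' in nhds ω, minWeight ω' N ⊆ minWeight ω N := by
  have h : ∀ᶠ ω' in nhds ω, ∀ J ∈ N, J ∉ minWeight ω N → J ∉ minWeight ω' N := by
    rw [hN.eventually_all]
    intro J hJ
    by_cases hJm : J ∈ minWeight ω N
    · exact Filter.Eventually.of_forall fun _ h => absurd hJm h
    · have : ∃ J' ∈ N, wt ω (expSum J') < wt ω (expSum J) := by
        by_contra hcon
        push Not at hcon
        exact hJm ⟨hJ, hcon⟩
      obtain ⟨J', hJ', hlt⟩ := this
      filter_upwards [(continuous_wt (expSum J')).continuousAt.eventually_lt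
        (continuous_wt (expSum J)).continuousAt hlt] with ω' hω' _ hmem
      exact absurd (hmem.2 J' hJ') (not_le.2 hω')
  filter_upwards [h] with ω' hω' J hJ
  by_contra hcon
  exact hω' J hJ.1 hcon hJ

theorem wt_single (i : Fin 3) (m : Fin 3 →₀ ℕ) : wt (Pi.single i 1) m = m i := by
  rw [wt, Finset.sum_eq_single i]
  · simp
  · intro j _ hj
    simp [hj]
  · simp

/-- A small step along axis `i` can only lose minimisers, so it can only enlarge the cone. By
maximality the cone is unchanged, `J` and `J'` still tie, and their sums agree in coordinate `i`. -/
theorem expSum_eq_of_maximal {N : Set (Finset (Fin 3 →₀ ℕ))} (hN : N.Finite) {ω : Fin 3 → ℝ}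
    (hmax : faceCone N ω ∈ maximalCones (Set.range (faceCone N))) {J J' : Finset (Fin 3 →₀ ℕ)}
    (hJ : J ∈ minWeight ω N) (hJ' : J' ∈ minWeight ω N) : expSum J = expSum J' := by
  ext i
  have hlim : Filter.Tendsto (fun t : ℝ => ω + t • (Pi.single i 1 : Fin 3 → ℝ))
      (nhdsWithin 0 (Set.Ioi 0)) (nhds ω) := by
    have hc : Continuous fun t : ℝ => ω + t • (Pi.single i 1 : Fin 3 → ℝ) := by fun_prop
    have := hc.tendsto 0
    simp only [zero_smul, add_zero] at this
    exact this.mono_left nhdsWithin_le_nhds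
  obtain ⟨t, hsub, ht⟩ := ((hlim.eventually (eventually_minWeight_subset hN ω)).and
    self_mem_nhdsWithin).exists
  have hle : faceCone N ω ≤ faceCone N (ω + t • Pi.single i 1) :=
    fun ω' hω' => subset_trans hsub hω'
  have hmem : ω + t • Pi.single i 1 ∈ faceCone N ω :=
    hmax.2 ⟨_, rfl⟩ hle (subset_refl (minWeight _ N))
  have h1 := le_antisymm ((hmem hJ).2 J' hJ'.1) ((hmem hJ').2 J hJ.1)
  rw [wt_add_smul, wt_add_smul, le_antisymm (hJ.2 J' hJ'.1) (hJ'.2 J hJ.1), wt_single,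
    wt_single] at h1
  exact_mod_cast mul_left_cancel₀ (ne_of_gt ht) (add_left_cancel h1)

theorem existsUnique_minCone {N : Set (Finset (Fin 3 →₀ ℕ))} (hN : N.Finite) (hne : N.Nonempty)
    {C : Set (Fin 3 → ℝ)} (hC : C ∈ maximalCones (Set.range (faceCone N))) :
    ∃! m : Fin 3 →₀ ℕ, m ∈ expSum '' N ∧ C = minCone (expSum '' N) m := by
  obtain ⟨ω, rfl⟩ := hC.1
  obtain ⟨J, hJ⟩ := minWeight_nonempty ω hN hne
  refine ⟨expSum J, ⟨⟨J, hJ.1, rfl⟩, ?_⟩, ?_⟩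
  · ext ω'
    constructor
    · rintro h _ ⟨J', hJ', rfl⟩
      exact (h hJ).2 J' hJ'
    · intro h J₁ hJ₁
      refine ⟨hJ₁.1, fun J' hJ' => ?_⟩
      rw [expSum_eq_of_maximal hN hC hJ₁ hJ]
      exact h _ ⟨J', hJ', rfl⟩
  · rintro _ ⟨⟨J', hJ', rfl⟩, heq⟩
    -- The cone contains `ω`, so any `m` that cuts it out is minimal at `ω`.
    have hω : ω ∈ faceCone N ω := subset_refl (minWeight ω N)
    rw [heq] at hω
    exact expSum_eq_of_maximal hN hC ⟨hJ', fun J₁ hJ₁ => hω _ ⟨J₁, hJ₁, rfl⟩⟩ hJ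

theorem exists_injective_minCone {F : Set (Set (Fin 3 → ℝ))} {M : Set (Fin 3 →₀ ℕ)}
    (h : ∀ C ∈ maximalCones F, ∃! m : Fin 3 →₀ ℕ, m ∈ M ∧ C = minCone M m) :
    ∃ φ : maximalCones F → M, (∀ C, C.1 = minCone M (φ C).1) ∧ Function.Injective φ := by
  choose m hm _ using h
  refine ⟨fun C => ⟨m C.1 C.2, (hm C.1 C.2).1⟩, fun C => (hm C.1 C.2).2, fun C C' hCC' => ?_⟩
  apply Subtype.ext
  have h : m C.1 C.2 = m C'.1 C'.2 := congrArg Subtype.val hCC'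
  rw [(hm C.1 C.2).2, (hm C'.1 C'.2).2, h]

theorem existsUnique_minCone_of_mem_maximalCones (hI : IsGradedIdeal I)
    (hd : Module.finrank K (degPart I d) = d + 1) {C : Set (Fin 3 → ℝ)}
    (hC : C ∈ maximalCones (groebnerFan I d)) :
    ∃! m : Fin 3 →₀ ℕ, m ∈ expSums I d ∧ C = minCone (expSums I d) m := by
  rw [groebnerFan_eq hI hd] at hC
  exact existsUnique_minCone (finite_pluckerSupport I d) (pluckerSupport_nonempty hd) hC

end Fan

/-! ### Linear changes of coordinates -/

section CoordChange

/-- The linear change of coordinates `x_i ↦ ∑ j, g_ij x_j`. -/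
def linearSubst (g : Matrix (Fin 3) (Fin 3) K) :
    MvPolynomial (Fin 3) K →ₐ[K] MvPolynomial (Fin 3) K :=
  aeval fun i => ∑ j, C (g i j) * X j

theorem linearSubst_X (g : Matrix (Fin 3) (Fin 3) K) (i : Fin 3) :
    linearSubst g (X i) = ∑ j, C (g i j) * X j :=
  aeval_X _ i

theorem linearSubst_one : linearSubst (1 : Matrix (Fin 3) (Fin 3) K) = AlgHom.id K _ := by
  ext1 i
  rw [linearSubst_X, Finset.sum_eq_single i]
  · simp
  · intro j _ hj
    simp [Matrix.one_apply_ne hj.symm]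
  · simp

theorem linearSubst_comp (g h : Matrix (Fin 3) (Fin 3) K) :
    (linearSubst g).comp (linearSubst h) = linearSubst (h * g) := by
  ext1 i
  have hC : ∀ c : K, linearSubst g (C c) = C c := fun c => (linearSubst g).commutes c
  rw [AlgHom.comp_apply, linearSubst_X, linearSubst_X, map_sum]
  simp only [map_mul, hC, linearSubst_X, Matrix.mul_apply, map_sum, Finset.sum_mul, Finset.mul_sum]
  rw [Finset.sum_comm]
  exact Finset.sum_congr rfl fun j _ => Finset.sum_congr rfl fun k _ => by ring

/-- The linear change of coordinates given by an invertible matrix. -/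
def linearSubstEquiv (g : GL (Fin 3) K) :
    MvPolynomial (Fin 3) K ≃ₐ[K] MvPolynomial (Fin 3) K :=
  AlgEquiv.ofAlgHom (linearSubst g.val) (linearSubst g⁻¹.val)
    (by rw [linearSubst_comp, ← Units.val_mul, inv_mul_cancel, Units.val_one, linearSubst_one])
    (by rw [linearSubst_comp, ← Units.val_mul, mul_inv_cancel, Units.val_one, linearSubst_one])

theorem linearSubstEquiv_symm_apply (g : GL (Fin 3) K) (f : MvPolynomial (Fin 3) K) :
    (linearSubstEquiv g).symm f = linearSubst g⁻¹.val f :=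
  rfl

theorem isHomogeneous_linearSubst (g : Matrix (Fin 3) (Fin 3) K) {f : MvPolynomial (Fin 3) K}
    {e : ℕ} (hf : f.IsHomogeneous e) : (linearSubst g f).IsHomogeneous e := by
  have h := hf.aeval (fun i => ∑ j, C (g i j) * X j : Fin 3 → MvPolynomial (Fin 3) K) (n := 1)
    fun i => IsHomogeneous.sum _ _ _ fun j _ => by
      simpa using (isHomogeneous_C (Fin 3) (g i j)).mul (isHomogeneous_X K j)
  rwa [one_mul] at h

theorem mem_coordChange {g : GL (Fin 3) K} {I : Ideal (MvPolynomial (Fin 3) K)}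
    {f : MvPolynomial (Fin 3) K} :
    f ∈ coordChange g I ↔ (linearSubstEquiv g).symm f ∈ I := by
  have : coordChange g I = I.map (linearSubstEquiv g) := rfl
  rw [this, Ideal.mem_map_of_equiv]
  constructor
  · rintro ⟨x, hx, rfl⟩
    simpa using hx
  · intro h
    exact ⟨_, h, by simp⟩

theorem homogeneousComponent_linearSubst (g : Matrix (Fin 3) (Fin 3) K)
    (f : MvPolynomial (Fin 3) K) (e : ℕ) :
    homogeneousComponent e (linearSubst g f) = linearSubst g (homogeneousComponent e f) := by
  conv_lhs => rw [← sum_homogeneousComponent f, map_sum, map_sum]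
  have h : ∀ i, homogeneousComponent e (linearSubst g (homogeneousComponent i f)) =
      if e = i then linearSubst g (homogeneousComponent i f) else 0 := fun i =>
    homogeneousComponent_of_mem
      (isHomogeneous_linearSubst g (homogeneousComponent_isHomogeneous i f))
  simp only [h, Finset.sum_ite_eq, Finset.mem_range]
  split_ifs with he
  · rfl
  · rw [homogeneousComponent_eq_zero e f (by omega), map_zero]

theorem isGradedIdeal_coordChange (g : GL (Fin 3) K) {I : Ideal (MvPolynomial (Fin 3) K)}
    (hI : IsGradedIdeal I) : IsGradedIdeal (coordChange g I) := by
  rw [isGradedIdeal_iff] at hI ⊢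
  intro e f hf
  rw [mem_coordChange, linearSubstEquiv_symm_apply] at hf ⊢
  rw [← homogeneousComponent_linearSubst]
  exact hI e _ hf

theorem degPart_coordChange (g : GL (Fin 3) K) (I : Ideal (MvPolynomial (Fin 3) K)) (d : ℕ) :
    degPart (coordChange g I) d =
      (degPart I d).map ((linearSubstEquiv g).toLinearEquiv : _ →ₗ[K] _) := by
  ext f
  rw [mem_degPart, mem_coordChange, Submodule.mem_map]
  constructor
  · rintro ⟨h1, h2⟩
    exact ⟨_, ⟨h1, isHomogeneous_linearSubst _ h2⟩, (linearSubstEquiv g).apply_symm_apply f⟩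
  · rintro ⟨p, ⟨hp1, hp2⟩, rfl⟩
    refine ⟨?_, isHomogeneous_linearSubst _ hp2⟩
    exact ((linearSubstEquiv g).symm_apply_apply p).symm ▸ hp1

theorem finrank_degPart_coordChange (g : GL (Fin 3) K) (I : Ideal (MvPolynomial (Fin 3) K))
    (d : ℕ) :
    Module.finrank K (degPart (coordChange g I) d) = Module.finrank K (degPart I d) := by
  rw [degPart_coordChange, LinearEquiv.finrank_map_eq]

/-- The substitution `x_i ↦ ∑ j, g_ij x_j` for the generic matrix `g`. -/
def genericSubst :
    MvPolynomial (Fin 3) K →ₐ[K] MvPolynomial (Fin 3) (MvPolynomial (Fin 3 × Fin 3) K) :=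
  aeval fun i => ∑ j, C (X (i, j)) * X j

theorem eval_coeff_genericSubst (g : Matrix (Fin 3) (Fin 3) K) (f : MvPolynomial (Fin 3) K)
    (ν : Fin 3 →₀ ℕ) :
    eval (fun ij : Fin 3 × Fin 3 => g ij.1 ij.2) (coeff ν (genericSubst f)) =
      coeff ν (linearSubst g f) := by
  have h : (mapAlgHom (aeval fun ij : Fin 3 × Fin 3 => g ij.1 ij.2)).comp genericSubst =
      linearSubst g := by
    ext1 i
    simp [genericSubst, linearSubst_X, map_sum]
  rw [← h, AlgHom.comp_apply, mapAlgHom_apply, coeff_map]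
  rfl

/-- The polynomial is the minor of a basis of `I_d` after the generic substitution; its value at `g`
is the Plücker coordinate in the transported basis. -/
theorem exists_pluckerPolynomial {I : Ideal (MvPolynomial (Fin 3) K)} {d : ℕ}
    (hd : Module.finrank K (degPart I d) = d + 1) {J : Finset (Fin 3 →₀ ℕ)}
    (hJ : J ∈ indexSets d) :
    ∃ P : MvPolynomial (Fin 3 × Fin 3) K, ∀ g : GL (Fin 3) K,
      J ∈ pluckerSupport (coordChange g I) d ↔
        eval (fun ij : Fin 3 × Fin 3 => g.val ij.1 ij.2) P ≠ 0 := by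
  have : FiniteDimensional K (degPart I d) := Module.finite_of_finrank_pos (by omega)
  let b := (Module.finBasisOfFinrankEq K _ hd).reindex
    (Fintype.equivOfCardEq (by rw [Fintype.card_fin, Fintype.card_coe, hJ.2]) : Fin (d + 1) ≃ J)
  refine ⟨(Matrix.of fun i ν : J =>
    coeff ν.1 (genericSubst (b i : MvPolynomial (Fin 3) K))).det, fun g => ?_⟩
  let e := ((linearSubstEquiv g).toLinearEquiv.submoduleMap (degPart I d)).trans
    (LinearEquiv.ofEq _ _ (degPart_coordChange g I d).symm)
  have heval : eval (fun ij : Fin 3 × Fin 3 => g.val ij.1 ij.2) (Matrix.of fun i ν : J =>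
      coeff ν.1 (genericSubst (b i : MvPolynomial (Fin 3) K))).det =
        pluckerCoord J (b.map e) := by
    rw [RingHom.map_det, pluckerCoord]
    congr 1
    ext i ν
    exact eval_coeff_genericSubst g.val _ _
  rw [heval]
  exact ⟨fun h => (pluckerCoord_ne_zero_iff J _ _).1 h.2.choose_spec, fun h => ⟨hJ, _, h⟩⟩

end CoordChange

/-! ### Generic coordinates -/

section Generic

theorem generically_iff [Infinite K] {p : GL (Fin 3) K → Prop} :
    Generically p ↔ ∃ q : MvPolynomial (Fin 3 × Fin 3) K, q ≠ 0 ∧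
      ∀ g : GL (Fin 3) K, eval (fun ij : Fin 3 × Fin 3 => g.val ij.1 ij.2) q ≠ 0 → p g := by
  constructor
  · rintro ⟨_, ⟨P, rfl⟩, ⟨g, q, hq, hg⟩, h⟩
    exact ⟨q, fun h0 => hg (by rw [h0, map_zero]), fun g hg => h g ⟨q, hq, hg⟩⟩
  · rintro ⟨q, hq, h⟩
    refine ⟨_, ⟨{q}, rfl⟩, ?_, fun g ⟨q', hq', hg⟩ => h g (hq' ▸ hg)⟩
    -- The factor `det` ensures that a point where the product is nonzero is an invertible matrix.
    have hprod : (Matrix.mvPolynomialX (Fin 3) (Fin 3) K).det * q ≠ 0 :=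
      mul_ne_zero (Matrix.det_mvPolynomialX_ne_zero (Fin 3) K) hq
    have : ∃ x : Fin 3 × Fin 3 → K,
        eval x ((Matrix.mvPolynomialX (Fin 3) (Fin 3) K).det * q) ≠ 0 := by
      by_contra hcon
      push Not at hcon
      exact hprod (MvPolynomial.funext fun x => by rw [hcon, map_zero])
    obtain ⟨x, hx⟩ := this
    rw [map_mul, RingHom.map_det] at hx
    have hA : (eval x).mapMatrix (Matrix.mvPolynomialX (Fin 3) (Fin 3) K) =
        Matrix.of fun i j => x (i, j) := by
      ext i j
      simp
    rw [hA] at hx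
    exact ⟨Matrix.GeneralLinearGroup.mkOfDetNeZero _ (left_ne_zero_of_mul hx), q, rfl,
      right_ne_zero_of_mul hx⟩

theorem Generically.mono {p p' : GL (Fin 3) K → Prop} (h : Generically p)
    (hpp' : ∀ g, p g → p' g) : Generically p' := by
  obtain ⟨U, hU, hne, h⟩ := h
  exact ⟨U, hU, hne, fun g hg => hpp' g (h g hg)⟩

theorem Generically.and [Infinite K] {p p' : GL (Fin 3) K → Prop} (h : Generically p)
    (h' : Generically p') : Generically fun g => p g ∧ p' g := by
  rw [generically_iff] at h h' ⊢
  obtain ⟨q, hq, h⟩ := h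
  obtain ⟨q', hq', h'⟩ := h'
  refine ⟨q * q', mul_ne_zero hq hq', fun g hg => ?_⟩
  rw [map_mul] at hg
  exact ⟨h g (left_ne_zero_of_mul hg), h' g (right_ne_zero_of_mul hg)⟩

theorem Generically.exists {p : GL (Fin 3) K → Prop} (h : Generically p) : ∃ g, p g := by
  obtain ⟨U, _, ⟨g, hg⟩, h⟩ := h
  exact ⟨g, h g hg⟩

theorem generically_ball_of_finite [Infinite K] {α : Type*} {s : Set α} (hs : s.Finite)
    {p : α → GL (Fin 3) K → Prop} (h : ∀ a ∈ s, Generically (p a)) :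
    Generically fun g => ∀ a ∈ s, p a g := by
  induction s, hs using Set.Finite.induction_on with
  | empty => exact generically_iff.2 ⟨1, one_ne_zero, by simp⟩
  | @insert a s _ _ ih =>
    refine ((h a (Set.mem_insert a s)).and
      (ih fun b hb => h b (Set.mem_insert_of_mem a hb))).mono fun g hg b hb => ?_
    rcases hb with rfl | hb
    · exact hg.1
    · exact hg.2 b hb

variable [Infinite K] {I : Ideal (MvPolynomial (Fin 3) K)} {d : ℕ}

/-- For each `J` the Plücker polynomial is either zero, and `J` never occurs, or nonzero, and `J`
occurs generically. -/
theorem generically_pluckerSupport_eq (hd : Module.finrank K (degPart I d) = d + 1) :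
    Generically fun g : GL (Fin 3) K =>
      pluckerSupport (coordChange g I) d = genericPluckerSupport I d := by
  have key : ∀ J ∈ indexSets d, Generically fun g : GL (Fin 3) K =>
      (J ∈ pluckerSupport (coordChange g I) d ↔ J ∈ genericPluckerSupport I d) := by
    intro J hJ
    obtain ⟨P, hP⟩ := exists_pluckerPolynomial hd hJ
    by_cases hP0 : P = 0
    · have hnot : ∀ g : GL (Fin 3) K, J ∉ pluckerSupport (coordChange g I) d := fun g hg =>
        (hP g).1 hg (by rw [hP0, map_zero])
      refine generically_iff.2 ⟨1, one_ne_zero, fun g _ => iff_of_false (hnot g) fun h => ?_⟩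
      obtain ⟨g', hg'⟩ := Generically.exists h
      exact hnot g' hg'
    · exact generically_iff.2 ⟨P, hP0, fun g hg => iff_of_true ((hP g).2 hg)
        (generically_iff.2 ⟨P, hP0, fun g' hg' => (hP g').2 hg'⟩)⟩
  refine (generically_ball_of_finite (finite_indexSets d) key).mono fun g hg => ?_
  ext J
  by_cases hJ : J ∈ indexSets d
  · exact hg J hJ
  · refine iff_of_false (fun h => hJ h.1) fun h => ?_
    obtain ⟨g', hg'⟩ := Generically.exists h
    exact hJ hg'.1

theorem generically_groebnerFan_eq (hI : IsGradedIdeal I)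
    (hd : Module.finrank K (degPart I d) = d + 1) :
    Generically fun g : GL (Fin 3) K =>
      groebnerFan (coordChange g I) d = genericGroebnerFan I d ∧
        pluckerSupport (coordChange g I) d = genericPluckerSupport I d := by
  have hfan : ∀ g : GL (Fin 3) K, groebnerFan (coordChange g I) d =
      Set.range (faceCone (pluckerSupport (coordChange g I) d)) := fun g =>
    groebnerFan_eq (isGradedIdeal_coordChange g hI) ((finrank_degPart_coordChange g I d).trans hd)
  have hgen := generically_pluckerSupport_eq hd
  refine hgen.mono fun g hg => ⟨?_, hg⟩
  ext C
  constructor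
  · intro hC
    refine hgen.mono fun g' hg' => ?_
    rwa [hfan, hg', ← hg, ← hfan]
  · intro hC
    -- Two generic conditions meet, so some `g'` has both `C` in its fan and the generic support,
    -- which is also that of `g`.
    obtain ⟨g', hg', hC'⟩ := (hgen.and hC).exists
    rwa [hfan, hg, ← hg', ← hfan]

end Generic

end GenericGroebner

end

theorem mainTheorem7 {K : Type*} [Field K] (I : Ideal (MvPolynomial (Fin 3) K))
    (hI : GenericGroebner.IsGradedIdeal I) (d : ℕ)
    (hd : Module.finrank K (GenericGroebner.degPart I d) = d + 1) :
    -- the degree `d` Gröbner fan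
    ((∀ C ∈ GenericGroebner.maximalCones (GenericGroebner.groebnerFan I d),
        ∃! m : Fin 3 →₀ ℕ, m ∈ GenericGroebner.expSums I d ∧
          C = GenericGroebner.minCone (GenericGroebner.expSums I d) m) ∧
      ∃ φ : GenericGroebner.maximalCones (GenericGroebner.groebnerFan I d) →
          GenericGroebner.expSums I d,
        (∀ C, C.1 = GenericGroebner.minCone (GenericGroebner.expSums I d) (φ C).1) ∧
          Function.Injective φ) ∧
    -- the degree `d` generic Gröbner fan
    (Infinite K →
      -- the generic objects are the common values at generic coordinates
      GenericGroebner.Generically (fun g : GL (Fin 3) K =>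
        GenericGroebner.groebnerFan (GenericGroebner.coordChange g I) d =
            GenericGroebner.genericGroebnerFan I d ∧
          GenericGroebner.pluckerSupport (GenericGroebner.coordChange g I) d =
            GenericGroebner.genericPluckerSupport I d) ∧
      (∀ C ∈ GenericGroebner.maximalCones (GenericGroebner.genericGroebnerFan I d),
        ∃! m : Fin 3 →₀ ℕ, m ∈ GenericGroebner.genericExpSums I d ∧
          C = GenericGroebner.minCone (GenericGroebner.genericExpSums I d) m) ∧
      ∃ φ : GenericGroebner.maximalCones (GenericGroebner.genericGroebnerFan I d) →
          GenericGroebner.genericExpSums I d,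
        (∀ C, C.1 = GenericGroebner.minCone (GenericGroebner.genericExpSums I d) (φ C).1) ∧
          Function.Injective φ) := by
  open GenericGroebner in
  have h1 : ∀ C ∈ maximalCones (groebnerFan I d), ∃! m : Fin 3 →₀ ℕ,
      m ∈ expSums I d ∧ C = minCone (expSums I d) m := fun C hC =>
    existsUnique_minCone_of_mem_maximalCones hI hd hC
  refine ⟨⟨h1, GenericGroebner.exists_injective_minCone h1⟩, fun hK => ?_⟩
  have hgen := GenericGroebner.generically_groebnerFan_eq hI hd
  obtain ⟨g, hfan, hplu⟩ := hgen.exists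
  open GenericGroebner in
  have h2 : ∀ C ∈ maximalCones (genericGroebnerFan I d), ∃! m : Fin 3 →₀ ℕ,
      m ∈ genericExpSums I d ∧ C = minCone (genericExpSums I d) m := by
    intro C hC
    rw [genericExpSums, ← hplu]
    rw [← hfan] at hC
    exact existsUnique_minCone_of_mem_maximalCones (isGradedIdeal_coordChange g hI)
      ((finrank_degPart_coordChange g I d).trans hd) hC
  exact ⟨hgen, h2, GenericGroebner.exists_injective_minCone h2⟩
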